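/- **Theorem.** Let $B>0$ (the Bond number) and $V>0$. Let $\mathcal M_V$ be the set of all continuous, piecewise continuously differentiable functions $h$ on $[0,1]$ with $h\ge 0$ on $[0,1]$ and $\int_0^1 h\,r\,dr=V/(2\pi)$. Let $V_1^1(0,1)$ be the space of real functions $f$ on $(0,1)$ with a weak derivative $f'$ such that $$\int_0^1\Big(f^2\,r+(f')^2\,r+\frac{f^2}{r}\Big)\,dr<\infty,$$ and let $\mathring V_1^1(0,1)$ be the subspace of those $f$ with trace zero at $r=1$. For $h\in\mathcal M_V$ define the fundamental shallow sloshing frequency with one nodal diameter ($m=1$) and pinned contact line by $$\Omega_{1,1}(h)=\inf\left\{\frac12\int_0^1 h\Big[(\psi')^2+\frac{\psi^2}{r^2}\Big]r\,dr+\frac12\int_0^1\Big[\zeta^2+\frac1B\Big((\zeta')^2+\frac{\zeta^2}{r^2}\Big)\Big]r\,dr\right\},$$ where the infimum is over all $(\psi,\zeta)\in V_1^1(0,1)\times\mathring V_1^1(0,1)$ with $\int_0^1\psi\,\zeta\,r\,dr=1$, and put $\lambda_{1,1}(h)=\Omega_{1,1}(h)^2$. Let $I_n$ denote the modified Bessel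 function of the first kind of order $n$. Then $1-\frac{4I_2(\sqrt B)}{\sqrt B\,I_1(\sqrt B)}>0$, and for every $h\in\mathcal M_V$ $$\lambda_{1,1}(h)\le\lambda_{1,1}^*:=\frac{4V}{\pi}\left[1-\frac{4I_2(\sqrt B)}{\sqrt B\,I_1(\sqrt B)}\right]^{-1}.$$ Moreover, the function $$h_1^*(r)=\frac{\lambda_{1,1}^*}{2}(1-r^2)-\frac{\lambda_{1,1}^*}{\sqrt B\,I_1(\sqrt B)}\Big[I_0(\sqrt B)-I_0(\sqrt B\,r)\Big]$$ belongs to $\mathcal M_V$ and satisfies $\lambda_{1,1}(h_1^*)=\lambda_{1,1}^*$, and the container bottom $z=-h_1^*(r)$ is not a convex function of $r$ on $[0,1]$. -/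

import Mathlib

open Set MeasureTheory
open scoped ContDiff

noncomputable section

namespace Sloshing

/-- Modified Bessel function of the first kind of integer order `n ≥ 0`:
`I_n(z) = ∑_{k ≥ 0} (z/2)^(2k+n) / (k! (n+k)!)` (an everywhere convergent series). -/
def besselI (n : ℕ) (z : ℝ) : ℝ :=
  ∑' k : ℕ, (z / 2) ^ (2 * k + n) / ((Nat.factorial k : ℝ) * (Nat.factorial (n + k) : ℝ))

/-- `PC¹[a, b]`: continuous on `[a, b]`, and `C¹` on each closed subinterval (with one-sided
derivatives at its endpoints) of some finite partition `a = t₀ < t₁ < ⋯ < t_n = b`. -/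
def PiecewiseC1 (a b : ℝ) (h : ℝ → ℝ) : Prop :=
  ContinuousOn h (Icc a b) ∧
    ∃ (n : ℕ) (t : ℕ → ℝ), t 0 = a ∧ t n = b ∧
      ∀ i < n, t i < t (i + 1) ∧ ContDiffOn ℝ 1 h (Icc (t i) (t (i + 1)))

/-- The admissible class `M_V`: nonnegative `h ∈ PC¹[0, 1]` with `∫₀¹ h r dr = V / (2π)`. -/
def shapeClass (V : ℝ) : Set (ℝ → ℝ) :=
  {h | PiecewiseC1 0 1 h ∧ (∀ r ∈ Icc (0 : ℝ) 1, 0 ≤ h r) ∧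
    ∫ r in (0 : ℝ)..1, h r * r = V / (2 * Real.pi)}

/-- Membership in the weighted space `L²_k(0, 1)`: `∫₀¹ f² r^k dr < ∞`. -/
def MemL2 (k : ℤ) (f : ℝ → ℝ) : Prop :=
  AEStronglyMeasurable f (volume.restrict (Ioo 0 1)) ∧
    IntegrableOn (fun r => f r ^ 2 * r ^ k) (Ioo 0 1)

/-- `g` is the weak (distributional) derivative of `f` on the interval `(0, 1)`. -/
def HasWeakDeriv (f g : ℝ → ℝ) : Prop :=
  LocallyIntegrableOn f (Ioo 0 1) ∧ LocallyIntegrableOn g (Ioo 0 1) ∧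
    ∀ η : ℝ → ℝ, ContDiff ℝ ∞ η → HasCompactSupport η → tsupport η ⊆ Ioo 0 1 →
      ∫ r in (0 : ℝ)..1, f r * deriv η r = -∫ r in (0 : ℝ)..1, g r * η r

/-- `f ∈ H¹₁(0, 1)` with weak derivative `f'`: both `f` and `f'` lie in `L²₁(0, 1)`. -/
def MemH (f f' : ℝ → ℝ) : Prop :=
  MemL2 1 f ∧ HasWeakDeriv f f' ∧ MemL2 1 f'

/-- `f ∈ V¹₁(0, 1) = H¹₁(0, 1) ∩ L²₋₁(0, 1)` with weak derivative `f'`. -/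
def MemV (f f' : ℝ → ℝ) : Prop :=
  MemH f f' ∧ MemL2 (-1) f

/-- `f` vanishes at `r = 1` in the sense of traces: the representative of `f` that is continuous
on `(0, 1]` takes the value `0` at `1`. -/
def ZeroTraceAtOne (f : ℝ → ℝ) : Prop :=
  ∃ g : ℝ → ℝ, ContinuousOn g (Ioc 0 1) ∧ g =ᵐ[volume.restrict (Ioo 0 1)] f ∧ g 1 = 0

/-- `f ∈ V̊¹₁(0, 1)`: elements of `V¹₁(0, 1)` that vanish at `r = 1`. -/
def MemVZero (f f' : ℝ → ℝ) : Prop :=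
  MemV f f' ∧ ZeroTraceAtOne f

/-- The energy `E_m(h; ψ, ζ)` with Bond number `B`; `ψ'`, `ζ'` are the derivatives. -/
def energy (B : ℝ) (m : ℕ) (h ψ ψ' ζ ζ' : ℝ → ℝ) : ℝ :=
  1 / 2 * (∫ r in (0 : ℝ)..1, h r * (ψ' r ^ 2 + (m : ℝ) ^ 2 / r ^ 2 * ψ r ^ 2) * r) +
  1 / 2 * (∫ r in (0 : ℝ)..1,
    (ζ r ^ 2 + 1 / B * (ζ' r ^ 2 + (m : ℝ) ^ 2 / r ^ 2 * ζ r ^ 2)) * r)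

/-- The energies of all `(ψ, ζ) ∈ V¹₁(0, 1) × V̊¹₁(0, 1)` with `∫₀¹ ψ ζ r dr = 1`, for one nodal
diameter (`m = 1`). -/
def admissibleEnergies (B : ℝ) (h : ℝ → ℝ) : Set ℝ :=
  {e | ∃ ψ ψ' ζ ζ' : ℝ → ℝ, MemV ψ ψ' ∧ MemVZero ζ ζ' ∧
    ∫ r in (0 : ℝ)..1, ψ r * ζ r * r = 1 ∧ e = energy B 1 h ψ ψ' ζ ζ'}

/-- The fundamental shallow sloshing frequency `Ω_{1,1}(h)`: the infimum of the energy
(the set of energies is nonempty and, for `h ≥ 0` and `B > 0`, bounded below by `0`). -/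
def fundamentalFreq (B : ℝ) (h : ℝ → ℝ) : ℝ := sInf (admissibleEnergies B h)

/-- The squared fundamental shallow sloshing frequency `λ_{1,1}(h) = Ω_{1,1}(h)²`. -/
def lam (B : ℝ) (h : ℝ → ℝ) : ℝ := fundamentalFreq B h ^ 2

/-- The bracket `1 - 4 I₂(√B) / (√B I₁(√B))`. -/
def bracket (B : ℝ) : ℝ :=
  1 - 4 * besselI 2 (Real.sqrt B) / (Real.sqrt B * besselI 1 (Real.sqrt B))

/-- The maximal value `λ*_{1,1} = (4V/π) [1 - 4 I₂(√B) / (√B I₁(√B))]⁻¹`. -/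
def lamStar (B V : ℝ) : ℝ := 4 * V / Real.pi * (bracket B)⁻¹

/-- The optimal profile `h*₁`. -/
def hStar (B V r : ℝ) : ℝ :=
  lamStar B V / 2 * (1 - r ^ 2) -
    lamStar B V / (Real.sqrt B * besselI 1 (Real.sqrt B)) *
      (besselI 0 (Real.sqrt B) - besselI 0 (Real.sqrt B * r))

end Sloshing

end

/-!
The upper bound comes from the trial potential `ψ = c r`. For it `(ψ')² + ψ²/r² = 2c²` is constant,
so its energy sees `h` only through the volume. Minimizing the surface energy under the coupling
constraint gives `ζ` proportional to `ζ₀(r) = r - I₁(√B r) / I₁(√B)`, which solves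
`(r ζ₀')' = ζ₀/r + B r ζ₀ - B r²`. Its surface energy and its coupling with `r` both equal a quarter
of `bracket B` (`integral_surf_energy`, `integral_surf_moment`), and balancing the two energies gives
the value `√λ*` for every admissible `h` (`sqrt_lamStar_mem_admissibleEnergies`).

The profile `h*` satisfies `h*' = -λ* ζ₀` and `h*(1) = 0`, which makes `(r, ζ₀)`, up to scaling, a
critical pair for `h*`; since `r` and `ζ₀` are positive, it is a minimizer, by Picone's argument.
Completing squares against the two positive functions (`picone_pointwise`) bounds the energy
density at `h*` below by
`(1/2) (h* ψ² + (r ζ₀'/ζ₀) ζ² / B)' + √λ* ψ ζ r`. After integration the second term contributes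
`√λ*`, and the flux in the first one has no negative contribution in the limit: at the axis `ψ` and
`ζ` are small along a sequence of radii because `∫ f²/r < ∞` (`exists_sq_add_sq_lt`), and at the wall
`h* ≥ 0` while `ζ² = o(1 - r)` (`sq_le_of_zeroTrace`) beats the simple pole of `ζ₀'/ζ₀`
(`exists_le_surfLogDeriv`). Weak derivatives are made accessible to the fundamental theorem of
calculus by passing to locally absolutely continuous representatives
(`HasWeakDeriv.exists_absolutelyContinuous`).

All facts on Bessel functions reduce to `Φ_n' = Φ_{n+1}` and one three-term recurrence for the
entire functions `Φ_n` with `I_n(z) = (z/2)^n Φ_n(z²/4)`. The bottom is not convex because its slope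
`λ* ζ₀` is positive inside and vanishes at `r = 1`.
-/

namespace Sloshing

/-! ### The power series behind the modified Bessel functions -/

/-- The entire function `Φ_n(x) = ∑ x^k / (k! (n+k)!)`, which carries the modified Bessel functions
through `I_n(z) = (z/2)^n Φ_n(z²/4)`. -/
noncomputable def bessPhi (n : ℕ) (x : ℝ) : ℝ :=
  ∑' k : ℕ, x ^ k / ((Nat.factorial k : ℝ) * (Nat.factorial (n + k) : ℝ))

lemma besselI_eq (n : ℕ) (z : ℝ) : besselI n z = (z / 2) ^ n * bessPhi n (z ^ 2 / 4) := by
  rw [besselI, bessPhi, ← tsum_mul_left]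
  congr 1
  ext k
  rw [pow_add, pow_mul, div_pow z 2 2]
  norm_num
  ring

lemma summable_bessPhi (n : ℕ) (x : ℝ) :
    Summable fun k : ℕ => x ^ k / ((Nat.factorial k : ℝ) * (Nat.factorial (n + k) : ℝ)) := by
  refine Summable.of_norm_bounded (Real.summable_pow_div_factorial |x|) fun k => ?_
  rw [norm_div, norm_pow, Real.norm_eq_abs, Real.norm_eq_abs,
    abs_of_pos (by positivity : (0 : ℝ) < (k.factorial : ℝ) * ((n + k).factorial : ℝ))]
  have h1 : (1 : ℝ) ≤ ((n + k).factorial : ℝ) := by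
    exact_mod_cast Nat.succ_le_of_lt (n + k).factorial_pos
  gcongr
  exact le_mul_of_one_le_right (by positivity) h1

lemma bessPhi_pos (n : ℕ) {x : ℝ} (hx : 0 ≤ x) : 0 < bessPhi n x :=
  (summable_bessPhi n x).tsum_pos (fun k => by positivity) 0 (by simp; positivity)

lemma hasDerivAt_bessPhi (n : ℕ) (x : ℝ) : HasDerivAt (bessPhi n) (bessPhi (n + 1) x) x := by
  set R : ℝ := |x| + 1
  have hR : 0 < R := by positivity
  have key (y : ℝ) (k : ℕ) : ((k + 1 : ℕ) : ℝ) * y ^ (k + 1 - 1) /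
      (((k + 1).factorial : ℝ) * ((n + (k + 1)).factorial : ℝ)) =
      y ^ k / ((k.factorial : ℝ) * ((n + 1 + k).factorial : ℝ)) := by
    rw [Nat.add_sub_cancel, Nat.factorial_succ k, show n + (k + 1) = n + 1 + k by ring]
    push_cast
    field_simp
  have hsum (y : ℝ) : Summable fun k : ℕ => (k : ℝ) * y ^ (k - 1) /
      ((k.factorial : ℝ) * ((n + k).factorial : ℝ)) := by
    rw [← summable_nat_add_iff 1]
    simpa only [key] using summable_bessPhi (n + 1) y
  have h := hasDerivAt_tsum_of_isPreconnected (𝕜 := ℝ)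
    (g := fun (k : ℕ) y => y ^ k / ((k.factorial : ℝ) * ((n + k).factorial : ℝ)))
    (g' := fun (k : ℕ) y => (k : ℝ) * y ^ (k - 1) / ((k.factorial : ℝ) * ((n + k).factorial : ℝ)))
    (t := Metric.ball 0 R) (hsum R) Metric.isOpen_ball
    (convex_ball (0 : ℝ) R).isPreconnected (fun k y _ => (hasDerivAt_pow k y).div_const _)
    (fun k y hy => ?_) (Metric.mem_ball_self hR) (summable_bessPhi n 0)
    (show x ∈ Metric.ball (0 : ℝ) R by simp [R])
  · convert! h using 1
    rw [(hsum x).tsum_eq_zero_add]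
    simp only [key]
    simp [bessPhi]
  · have hy' : |y| ≤ R := by simpa using (Metric.mem_ball.1 hy).le
    rw [norm_div, norm_mul, norm_pow, Real.norm_eq_abs, Real.norm_eq_abs, Real.norm_eq_abs,
      abs_of_pos (by positivity : (0 : ℝ) < (k.factorial : ℝ) * ((n + k).factorial : ℝ)),
      abs_of_nonneg (Nat.cast_nonneg k)]
    gcongr

lemma continuous_bessPhi (n : ℕ) : Continuous (bessPhi n) :=
  continuous_iff_continuousAt.2 fun x => (hasDerivAt_bessPhi n x).continuousAt

/-- The three-term recurrence, equivalent to `z I_{n+2}(z) + 2(n+1) I_{n+1}(z) = z I_n(z)`. -/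
lemma bessPhi_rec (n : ℕ) (x : ℝ) :
    bessPhi n x = (n + 1) * bessPhi (n + 1) x + x * bessPhi (n + 2) x := by
  have h1 := summable_bessPhi (n + 1) x
  have h2 := summable_bessPhi (n + 2) x
  have h0 := summable_bessPhi n x
  rw [bessPhi, bessPhi, bessPhi, h0.tsum_eq_zero_add, h1.tsum_eq_zero_add, mul_add,
    ← tsum_mul_left, ← tsum_mul_left, add_assoc,
    ← Summable.tsum_add (((summable_nat_add_iff 1).2 h1).mul_left _) (h2.mul_left _)]
  congr 1
  · simp [Nat.factorial_succ]
    field_simp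
  · congr 1
    ext k
    have e1 : n + 1 + (k + 1) = (n + k + 1) + 1 := by ring
    have e2 : n + 2 + k = (n + k + 1) + 1 := by ring
    have e3 : n + (k + 1) = n + k + 1 := by ring
    rw [e1, e2, e3, Nat.factorial_succ (n + k + 1), Nat.factorial_succ k]
    push_cast
    field_simp
    ring

lemma bessPhi_monotoneOn (n : ℕ) : MonotoneOn (bessPhi n) (Ici 0) := by
  refine monotoneOn_of_deriv_nonneg (convex_Ici 0) (continuous_bessPhi n).continuousOn
    (fun x _ => (hasDerivAt_bessPhi n x).differentiableAt.differentiableWithinAt) fun x hx => ?_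
  rw [(hasDerivAt_bessPhi n x).deriv]
  rw [interior_Ici] at hx
  exact (bessPhi_pos _ (le_of_lt hx)).le

/-- The tangent bound `Φ_n(y) - Φ_n(x) ≥ Φ_{n+1}(0) (y - x)` for `0 ≤ x ≤ y`. -/
lemma bessPhi_sub_ge (n : ℕ) {x y : ℝ} (hx : 0 ≤ x) (hxy : x ≤ y) :
    bessPhi (n + 1) 0 * (y - x) ≤ bessPhi n y - bessPhi n x := by
  refine (convex_Ici (0 : ℝ)).mul_sub_le_image_sub_of_le_deriv
    (continuous_bessPhi n).continuousOn
    (fun x _ => (hasDerivAt_bessPhi n x).differentiableAt.differentiableWithinAt)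
    (fun t ht => ?_) x hx y (hx.trans hxy) hxy
  rw [interior_Ici] at ht
  rw [(hasDerivAt_bessPhi n t).deriv]
  exact bessPhi_monotoneOn _ self_mem_Ici (mem_Ici.2 (le_of_lt ht)) (le_of_lt ht)

/-! ### Absolutely continuous representatives of weakly differentiable functions -/

lemma exists_Icc_of_isCompact_subset_Ioo {K : Set ℝ} {c d : ℝ} (hcd : c < d) (hK : IsCompact K)
    (hKI : K ⊆ Ioo c d) : ∃ a b, c < a ∧ a ≤ b ∧ b < d ∧ K ⊆ Icc a b := by
  rcases K.eq_empty_or_nonempty with rfl | hne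
  · obtain ⟨m, hm⟩ := exists_between hcd
    exact ⟨m, m, hm.1, le_rfl, hm.2, empty_subset _⟩
  · obtain ⟨a, ha, hal⟩ := hK.exists_isLeast hne
    obtain ⟨b, hb, hbu⟩ := hK.exists_isGreatest hne
    exact ⟨a, b, (hKI ha).1, hal hb, (hKI hb).2, fun x hx => ⟨hal hx, hbu hx⟩⟩

lemma intervalIntegral_eq_of_support {F : ℝ → ℝ} {a b c d : ℝ} (hca : c ≤ a) (hab : a ≤ b)
    (hbd : b ≤ d) (hF : ∀ x, x ∉ Icc a b → F x = 0) : ∫ x in c..d, F x = ∫ x in a..b, F x := by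
  rw [intervalIntegral.integral_of_le (hca.trans (hab.trans hbd)),
    intervalIntegral.integral_of_le hab, ← integral_Icc_eq_integral_Ioc,
    ← integral_Icc_eq_integral_Ioc]
  exact (setIntegral_eq_of_subset_of_forall_sdiff_eq_zero measurableSet_Icc
    (Icc_subset_Icc hca hbd) fun x hx => hF x hx.2)

lemma integrable_mul_test {f η : ℝ → ℝ} (hf : LocallyIntegrableOn f (Ioo 0 1))
    (hη : Continuous η) (hc : HasCompactSupport η) (hs : tsupport η ⊆ Ioo 0 1) :
    Integrable fun x => f x * η x := by
  rw [← integrableOn_iff_integrable_of_support_subset (s := tsupport η)]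
  · exact (hf.integrableOn_compact_subset hs hc).mul_continuousOn hη.continuousOn hc
  · exact (Function.support_mul_subset_right _ _).trans (subset_tsupport η)

/-- The fundamental lemma of the calculus of variations in its first-order form: a locally
integrable function with vanishing weak derivative is almost everywhere constant. Every test
function splits as a multiple of a fixed bump plus the derivative of a test function. -/
lemma ae_eq_const_of_weakDeriv_zero {v : ℝ → ℝ} (hv : LocallyIntegrableOn v (Ioo 0 1))
    (h : ∀ η : ℝ → ℝ, ContDiff ℝ ∞ η → HasCompactSupport η → tsupport η ⊆ Ioo 0 1 →
      ∫ r in (0 : ℝ)..1, v r * deriv η r = 0) :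
    ∃ c : ℝ, ∀ᵐ x, x ∈ Ioo (0 : ℝ) 1 → v x = c := by
  let φ : ContDiffBump (1 / 2 : ℝ) := ⟨1 / 8, 1 / 4, by norm_num, by norm_num⟩
  let β : ℝ → ℝ := φ.normed volume
  have hβs : ContDiff ℝ ∞ β := φ.contDiff_normed
  have hβc : HasCompactSupport β := φ.hasCompactSupport_normed
  have hβ1 : ∫ x, β x = 1 := φ.integral_normed
  have hβt : tsupport β ⊆ Ioo 0 1 := by
    rw [φ.tsupport_normed_eq]
    intro x hx
    simp only [Metric.mem_closedBall, Real.dist_eq, φ, abs_le] at hx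
    constructor <;> linarith [hx.1, hx.2]
  refine ⟨∫ x, v x * β x, ?_⟩
  set c := ∫ x, v x * β x
  have hvc : LocallyIntegrableOn (fun x => v x - c) (Ioo 0 1) :=
    hv.sub ((locallyIntegrable_const c).locallyIntegrableOn _)
  suffices ∀ᵐ x, x ∈ Ioo (0 : ℝ) 1 → v x - c = 0 by
    filter_upwards [this] with x hx hxI using sub_eq_zero.1 (hx hxI)
  refine isOpen_Ioo.ae_eq_zero_of_integral_contDiff_smul_eq_zero hvc fun η hη hηc hηt => ?_
  -- `τ = η - m β` has integral zero, so its primitive `θ` is again a test function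
  set m := ∫ x, η x
  let τ : ℝ → ℝ := fun x => η x - m * β x
  have hτs : ContDiff ℝ ∞ τ := hη.sub (contDiff_const.mul hβs)
  have hηi : Integrable η := hη.continuous.integrable_of_hasCompactSupport hηc
  have hβi : Integrable β := hβs.continuous.integrable_of_hasCompactSupport hβc
  obtain ⟨a, b, ha, hab, hb, hK⟩ := exists_Icc_of_isCompact_subset_Ioo (K := tsupport η ∪ tsupport β)
    zero_lt_one (IsCompact.union hηc hβc) (union_subset hηt hβt)
  have hτ0 : ∀ x, x ∉ Icc a b → τ x = 0 := fun x hx => by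
    have h1 : η x = 0 := image_eq_zero_of_notMem_tsupport fun h => hx (hK (Or.inl h))
    have h2 : β x = 0 := image_eq_zero_of_notMem_tsupport fun h => hx (hK (Or.inr h))
    simp [τ, h1, h2]
  have hτint : ∫ x, τ x = 0 := by
    rw [integral_sub hηi (hβi.const_mul m), integral_const_mul, hβ1]
    simp [m]
  let θ : ℝ → ℝ := fun x => ∫ t in (0 : ℝ)..x, τ t
  have hθd (x : ℝ) : HasDerivAt θ (τ x) x :=
    intervalIntegral.integral_hasDerivAt_right (hτs.continuous.intervalIntegrable _ _)
      (hτs.continuous.stronglyMeasurableAtFilter _ _) hτs.continuous.continuousAt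
  have hθ' : deriv θ = τ := funext fun x => (hθd x).deriv
  have hθs : ContDiff ℝ ∞ θ :=
    contDiff_infty_iff_deriv.2 ⟨fun x => (hθd x).differentiableAt, hθ' ▸ hτs⟩
  have hθ0 : ∀ x, x ∉ Icc a b → θ x = 0 := by
    intro x hx
    rcases lt_or_ge x a with hxa | hxa
    · refine (intervalIntegral.integral_congr (g := fun _ => 0) fun t ht => hτ0 t ?_).trans (by simp)
      intro h'
      have := ht.2
      rcases le_total 0 x with h0 | h0
      · rw [sup_of_le_right h0] at this; linarith [h'.1]
      · rw [sup_of_le_left h0] at this; linarith [h'.1]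
    · have hxb : b < x := lt_of_not_ge fun h' => hx ⟨hxa, h'⟩
      rw [show θ x = ∫ t in a..b, τ t from intervalIntegral_eq_of_support ha.le hab hxb.le hτ0,
        intervalIntegral.integral_of_le hab, ← integral_Icc_eq_integral_Ioc,
        setIntegral_eq_integral_of_forall_compl_eq_zero hτ0, hτint]
  have hθt : tsupport θ ⊆ Icc a b := by
    refine closure_minimal (fun x hx => ?_) isClosed_Icc
    by_contra h'
    exact hx (hθ0 x h')
  have h0 := h θ hθs (isCompact_Icc.of_isClosed_subset (isClosed_tsupport θ) hθt)
    (hθt.trans fun x hx => ⟨ha.trans_le hx.1, hx.2.trans_lt hb⟩)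
  rw [hθ'] at h0
  have e1 := integrable_mul_test hv hη.continuous hηc hηt
  have e2 := integrable_mul_test hv hβs.continuous hβc hβt
  have h1 : ∫ x, v x * η x - m * (v x * β x) = 0 := by
    rw [← h0, intervalIntegral.integral_of_le zero_le_one,
      setIntegral_eq_integral_of_forall_compl_eq_zero]
    · congr 1; ext x; simp only [τ]; ring
    · intro x hx
      rw [hτ0 x fun h' => hx ⟨ha.trans_le h'.1, h'.2.trans hb.le⟩, mul_zero]
  rw [integral_sub e1 (e2.const_mul m), integral_const_mul] at h1
  calc ∫ x, η x • (v x - c) = ∫ x, (v x * η x - c * η x) := by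
        congr 1; ext x; simp only [smul_eq_mul]; ring
    _ = 0 := by
        rw [integral_sub e1 (hηi.const_mul c), integral_const_mul]
        linarith [mul_comm c m]

/-- The continuous primitive of a locally integrable function has that function as its weak
derivative, and every function with the same weak derivative differs from it by a constant. Hence
a weakly differentiable function has a locally absolutely continuous representative, which is
differentiable almost everywhere with the weak derivative as its derivative. -/
lemma HasWeakDeriv.exists_absolutelyContinuous {f g : ℝ → ℝ} (h : HasWeakDeriv f g) :
    ∃ u : ℝ → ℝ, (∀ a b, 0 < a → a ≤ b → b < 1 → AbsolutelyContinuousOnInterval u a b) ∧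
      (∀ᵐ x, x ∈ Ioo (0 : ℝ) 1 → f x = u x) ∧
      ∀ᵐ x, x ∈ Ioo (0 : ℝ) 1 → HasDerivAt u (g x) x := by
  obtain ⟨hf, hg, hfg⟩ := h
  let u₀ : ℝ → ℝ := fun x => ∫ t in (1 / 2 : ℝ)..x, g t
  have hgi : ∀ a b, 0 < a → a ≤ b → b < 1 → IntervalIntegrable g volume a b := by
    intro a b ha hab hb
    rw [intervalIntegrable_iff_integrableOn_Icc_of_le hab]
    exact hg.integrableOn_compact_subset (fun x hx => ⟨ha.trans_le hx.1, hx.2.trans_lt hb⟩)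
      isCompact_Icc
  have hac : ∀ a b, 0 < a → a ≤ b → b < 1 → AbsolutelyContinuousOnInterval u₀ a b := by
    intro a b ha hab hb
    have hm : (1 / 2 : ℝ) ∈ uIcc (min a (1 / 2)) (max b (1 / 2)) := by
      rw [uIcc_of_le (by simp)]; exact ⟨min_le_right _ _, le_max_right _ _⟩
    refine (IntervalIntegrable.absolutelyContinuousOnInterval_intervalIntegral
      (hgi (min a (1 / 2)) (max b (1 / 2)) (lt_min ha (by norm_num)) (by simp)
        (max_lt hb (by norm_num))) hm).mono ?_
    rw [uIcc_of_le hab, uIcc_of_le (by simp)]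
    exact Icc_subset_Icc (min_le_left _ _) (le_max_left _ _)
  have hder : ∀ᵐ x, x ∈ Ioo (0 : ℝ) 1 → HasDerivAt u₀ (g x) x := by
    have : ∀ n : ℕ, ∀ᵐ x, x ∈ Icc (1 / ((n : ℝ) + 3)) (1 - 1 / ((n : ℝ) + 3)) →
        HasDerivAt u₀ (g x) x := by
      intro n
      have h3 : 1 / ((n : ℝ) + 3) ≤ 1 / 3 := by gcongr; simp
      have h3' : 0 < 1 / ((n : ℝ) + 3) := by positivity
      filter_upwards [(hgi (1 / ((n : ℝ) + 3)) (1 - 1 / ((n : ℝ) + 3)) h3' (by linarith)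
        (by linarith)).ae_hasDerivAt_integral] with x hx hxI
      rw [uIcc_of_le (by linarith)] at hx
      exact hx hxI _ ⟨by linarith, by linarith⟩
    filter_upwards [ae_all_iff.2 this] with x hx hxI
    obtain ⟨n, hn⟩ := exists_nat_one_div_lt (lt_min hxI.1 (sub_pos.2 hxI.2))
    have h3 : 1 / ((n : ℝ) + 3) ≤ 1 / (n + 1) := by gcongr; norm_num
    exact hx n ⟨by linarith [min_le_left x (1 - x)], by linarith [min_le_right x (1 - x)]⟩
  have hcont : ContinuousOn u₀ (Ioo 0 1) := by
    intro x hx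
    have hc := (hac (x / 2) ((x + 1) / 2) (by linarith [hx.1]) (by linarith [hx.1])
      (by linarith [hx.2])).continuousOn
    rw [uIcc_of_le (by linarith [hx.1])] at hc
    exact (hc.continuousAt (Icc_mem_nhds (by linarith [hx.1]) (by linarith [hx.2]))).continuousWithinAt
  have hu₀ : LocallyIntegrableOn u₀ (Ioo 0 1) :=
    hcont.locallyIntegrableOn measurableSet_Ioo
  obtain ⟨c, hc⟩ := ae_eq_const_of_weakDeriv_zero (hf.sub hu₀) fun η hη hηc hηt => by
    have hη' : Continuous (deriv η) := hη.continuous_deriv (by simp)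
    have ht' : tsupport (deriv η) ⊆ Ioo 0 1 := (tsupport_deriv_subset).trans hηt
    obtain ⟨a, b, ha, hab, hb, hK⟩ := exists_Icc_of_isCompact_subset_Ioo zero_lt_one hηc hηt
    obtain ⟨a', ha'⟩ := exists_between ha
    obtain ⟨b', hb'⟩ := exists_between hb
    have hz : ∀ x, x ∉ Icc a b → η x = 0 := fun x hx =>
      image_eq_zero_of_notMem_tsupport fun h => hx (hK h)
    have hz' : ∀ x, x ∉ Icc a b → deriv η x = 0 := fun x hx =>
      image_eq_zero_of_notMem_tsupport fun h => hx (hK (tsupport_deriv_subset h))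
    have hle : a' ≤ b' := by linarith [ha'.2, hb'.1]
    have hηac : AbsolutelyContinuousOnInterval η a' b' :=
      (hη.of_le (by simp)).contDiffOn.absolutelyContinuousOnInterval
    have hparts := (hac a' b' ha'.1 hle hb'.2).integral_mul_deriv_eq_deriv_mul hηac
    rw [hz a' (fun h => by linarith [h.1, ha'.2]), hz b' (fun h => by linarith [h.2, hb'.1])] at hparts
    have hg' : ∫ x in a'..b', deriv u₀ x * η x = ∫ x in a'..b', g x * η x := by
      refine intervalIntegral.integral_congr_ae ?_
      filter_upwards [hder] with x hx hxI
      rw [uIoc_of_le hle] at hxI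
      rw [(hx ⟨ha'.1.trans hxI.1, hxI.2.trans_lt hb'.2⟩).deriv]
    have e1 : ∫ r in (0 : ℝ)..1, u₀ r * deriv η r = ∫ r in a'..b', u₀ r * deriv η r :=
      intervalIntegral_eq_of_support ha'.1.le hle hb'.2.le fun x hx => by
        rw [hz' x fun h => hx ⟨ha'.2.le.trans h.1, h.2.trans hb'.1.le⟩, mul_zero]
    have e2 : ∫ r in (0 : ℝ)..1, g r * η r = ∫ r in a'..b', g r * η r :=
      intervalIntegral_eq_of_support ha'.1.le hle hb'.2.le fun x hx => by
        rw [hz x fun h => hx ⟨ha'.2.le.trans h.1, h.2.trans hb'.1.le⟩, mul_zero]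
    have i1 := (integrable_mul_test hf hη' hηc.deriv ht').intervalIntegrable (a := 0) (b := 1)
    have i2 := (integrable_mul_test hu₀ hη' hηc.deriv ht').intervalIntegrable (a := 0) (b := 1)
    have e3 : ∫ r in (0 : ℝ)..1, (f r - u₀ r) * deriv η r =
        (∫ r in (0 : ℝ)..1, f r * deriv η r) - ∫ r in (0 : ℝ)..1, u₀ r * deriv η r := by
      rw [← intervalIntegral.integral_sub i1 i2]
      congr 1; ext x; ring
    change ∫ r in (0 : ℝ)..1, (f r - u₀ r) * deriv η r = 0
    rw [e3, hfg η hη hηc hηt, e1, e2, hparts, hg']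
    ring
  refine ⟨fun x => u₀ x + c, fun a b ha hab hb => ?_, ?_, ?_⟩
  · exact (hac a b ha hab hb).fun_add
      (LipschitzWith.const c).lipschitzOnWith.absolutelyContinuousOnInterval
  · filter_upwards [hc] with x hx hxI
    have : f x - u₀ x = c := hx hxI
    linarith
  · filter_upwards [hder] with x hx hxI using (hx hxI).add_const c

/-! ### The optimal free surface and the optimal profile -/

/-- The optimal free surface `ζ₀(r) = r - I₁(√B r) / I₁(√B)` divided by `r`, extended smoothly to
`r = 0`. -/
noncomputable def surfRatio (B r : ℝ) : ℝ := 1 - bessPhi 1 (B / 4 * r ^ 2) / bessPhi 1 (B / 4)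

/-- The derivative of the optimal free surface `ζ₀(r) = r * surfRatio B r`, in closed form. -/
noncomputable def surfDeriv (B r : ℝ) : ℝ :=
  surfRatio B r - B / 2 * r ^ 2 * (bessPhi 2 (B / 4 * r ^ 2) / bessPhi 1 (B / 4))

lemma hasDerivAt_bessPhi_sq (n : ℕ) (B r : ℝ) :
    HasDerivAt (fun r => bessPhi n (B / 4 * r ^ 2)) (B / 2 * r * bessPhi (n + 1) (B / 4 * r ^ 2)) r := by
  have h := (hasDerivAt_bessPhi n (B / 4 * r ^ 2)).comp r ((hasDerivAt_pow 2 r).const_mul (B / 4))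
  convert! h using 1
  simp
  ring

lemma continuous_bessPhi_sq (n : ℕ) (B : ℝ) : Continuous fun r : ℝ => bessPhi n (B / 4 * r ^ 2) :=
  (continuous_bessPhi n).comp (by fun_prop)

lemma continuous_surfRatio (B : ℝ) : Continuous (surfRatio B) :=
  continuous_const.sub ((continuous_bessPhi_sq 1 B).div_const _)

lemma continuous_surfDeriv (B : ℝ) : Continuous (surfDeriv B) :=
  (continuous_surfRatio B).sub ((by fun_prop : Continuous fun r : ℝ => B / 2 * r ^ 2).mul
    ((continuous_bessPhi_sq 2 B).div_const _))

lemma hasDerivAt_surfRatio (B r : ℝ) : HasDerivAt (surfRatio B)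
    (-(B / 2 * r * bessPhi 2 (B / 4 * r ^ 2) / bessPhi 1 (B / 4))) r := by
  have h := ((hasDerivAt_bessPhi_sq 1 B r).div_const (bessPhi 1 (B / 4))).const_sub 1
  exact h

lemma hasDerivAt_surf (B r : ℝ) :
    HasDerivAt (fun r => r * surfRatio B r) (surfDeriv B r) r := by
  convert! (hasDerivAt_id r).mul (hasDerivAt_surfRatio B r) using 1
  simp only [surfDeriv, id]
  ring

lemma hasDerivAt_surfDeriv (B r : ℝ) : HasDerivAt (surfDeriv B)
    (-(B / 2 * r * (2 * bessPhi 1 (B / 4 * r ^ 2) - bessPhi 2 (B / 4 * r ^ 2)) /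
      bessPhi 1 (B / 4))) r := by
  have h := (hasDerivAt_surfRatio B r).sub
    (((hasDerivAt_pow 2 r).const_mul (B / 2)).mul
      ((hasDerivAt_bessPhi_sq 2 B r).div_const (bessPhi 1 (B / 4))))
  convert! h using 1
  have := bessPhi_rec 1 (B / 4 * r ^ 2)
  norm_num at this
  rw [this]
  simp
  ring

lemma surfRatio_one {B : ℝ} (hB : 0 < B) : surfRatio B 1 = 0 := by
  have := (bessPhi_pos 1 (x := B / 4) (by positivity)).ne'
  simp [surfRatio, this]

/-- The surface vanishes no faster than linearly at the wall, because `Φ₁' = Φ₂ ≥ Φ₂(0) > 0`. -/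
lemma surfRatio_ge {B r : ℝ} (hB : 0 < B) (hr : r ∈ Icc (0 : ℝ) 1) :
    bessPhi 2 0 * (B / 4) / bessPhi 1 (B / 4) * (1 - r) ≤ surfRatio B r := by
  have hD := bessPhi_pos 1 (x := B / 4) (by positivity)
  have h2 := bessPhi_pos 2 (x := 0) le_rfl
  have hr2 : r ^ 2 ≤ r := by nlinarith [hr.1, hr.2]
  have h := bessPhi_sub_ge 1 (x := B / 4 * r ^ 2) (y := B / 4) (by positivity)
    (mul_le_of_le_one_right (by positivity) (by nlinarith [hr.1, hr.2]))
  rw [surfRatio, ← div_self hD.ne', ← sub_div, div_self hD.ne', div_mul_eq_mul_div]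
  gcongr
  refine le_trans ?_ h
  rw [mul_assoc]
  have : B / 4 * (1 - r) ≤ B / 4 - B / 4 * r ^ 2 := by nlinarith
  exact mul_le_mul_of_nonneg_left this h2.le

lemma surfRatio_pos {B r : ℝ} (hB : 0 < B) (hr : r ∈ Ico (0 : ℝ) 1) : 0 < surfRatio B r := by
  have hD := bessPhi_pos 1 (x := B / 4) (by positivity)
  have h2 := bessPhi_pos 2 (x := 0) le_rfl
  have : 0 < 1 - r := by linarith [hr.2]
  exact lt_of_lt_of_le (by positivity) (surfRatio_ge hB ⟨hr.1, hr.2.le⟩)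

lemma surfRatio_nonneg {B r : ℝ} (hB : 0 < B) (hr : r ∈ Icc (0 : ℝ) 1) : 0 ≤ surfRatio B r := by
  have hD := bessPhi_pos 1 (x := B / 4) (by positivity)
  have h2 := bessPhi_pos 2 (x := 0) le_rfl
  have : 0 ≤ 1 - r := by linarith [hr.2]
  exact le_trans (by positivity) (surfRatio_ge hB hr)

/-- The scaled logarithmic derivative `r ζ₀' / ζ₀` of the optimal surface, written as the quotient of
`ζ₀'` by `ζ₀ / r` so that it is regular at the axis. -/
noncomputable def surfLogDeriv (B r : ℝ) : ℝ := surfDeriv B r / surfRatio B r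

/-- The Riccati equation of `r ζ₀' / ζ₀`, equivalent to `(r ζ₀')' = ζ₀ / r + B r ζ₀ - B r²`. -/
lemma hasDerivAt_surfLogDeriv {B r : ℝ} (hB : 0 < B) (hr : r ∈ Ioo (0 : ℝ) 1) :
    HasDerivAt (surfLogDeriv B)
      (1 / r + B * r - B * r / surfRatio B r - surfLogDeriv B r ^ 2 / r) r := by
  have hq := (surfRatio_pos hB ⟨hr.1.le, hr.2⟩).ne'
  have hr0 := hr.1.ne'
  have hD := (bessPhi_pos 1 (x := B / 4) (by positivity)).ne'
  convert! (hasDerivAt_surfDeriv B r).div (hasDerivAt_surfRatio B r) hq using 1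
  have h1 : bessPhi 1 (B / 4 * r ^ 2) = bessPhi 1 (B / 4) * (1 - surfRatio B r) := by
    rw [surfRatio]; field_simp; ring
  rw [surfLogDeriv, surfDeriv, h1]
  field_simp
  ring

lemma sqrt_mul_besselI_one {B : ℝ} (hB : 0 < B) :
    √B * besselI 1 √B = B / 2 * bessPhi 1 (B / 4) := by
  rw [besselI_eq, Real.sq_sqrt hB.le, pow_one, ← mul_assoc, ← mul_div_assoc, Real.mul_self_sqrt hB.le]

lemma bracket_eq {B : ℝ} (hB : 0 < B) :
    bracket B = 1 - 2 * bessPhi 2 (B / 4) / bessPhi 1 (B / 4) := by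
  have hD := (bessPhi_pos 1 (x := B / 4) (by positivity)).ne'
  rw [bracket, sqrt_mul_besselI_one hB, besselI_eq, div_pow, Real.sq_sqrt hB.le]
  field_simp
  ring

lemma bracket_pos {B : ℝ} (hB : 0 < B) : 0 < bracket B := by
  have hD := bessPhi_pos 1 (x := B / 4) (by positivity)
  have h3 := bessPhi_pos 3 (x := B / 4) (by positivity)
  have h := bessPhi_rec 1 (B / 4)
  norm_num at h
  rw [bracket_eq hB, sub_pos, div_lt_one hD, h]
  linarith [mul_pos (by positivity : 0 < B / 4) h3]

lemma lamStar_pos {B V : ℝ} (hB : 0 < B) (hV : 0 < V) : 0 < lamStar B V := by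
  have := bracket_pos hB
  rw [lamStar]
  positivity

lemma hStar_eq {B : ℝ} (hB : 0 < B) (V r : ℝ) : hStar B V r = lamStar B V / 2 * (1 - r ^ 2) -
    lamStar B V / (B / 2 * bessPhi 1 (B / 4)) * (bessPhi 0 (B / 4) - bessPhi 0 (B / 4 * r ^ 2)) := by
  rw [hStar, sqrt_mul_besselI_one hB, besselI_eq, besselI_eq, mul_pow, Real.sq_sqrt hB.le,
    show B * r ^ 2 / 4 = B / 4 * r ^ 2 by ring]
  simp

/-- The optimal profile is the potential of the optimal free surface, `h* ' = -λ* ζ₀`. -/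
lemma hasDerivAt_hStar {B : ℝ} (hB : 0 < B) (V r : ℝ) :
    HasDerivAt (hStar B V) (-(lamStar B V * (r * surfRatio B r))) r := by
  have hD := (bessPhi_pos 1 (x := B / 4) (by positivity)).ne'
  rw [show hStar B V = _ from funext (hStar_eq hB V)]
  convert! (((hasDerivAt_pow 2 r).const_sub 1).const_mul (lamStar B V / 2)).sub
    (((hasDerivAt_bessPhi_sq 0 B r).const_sub (bessPhi 0 (B / 4))).const_mul
      (lamStar B V / (B / 2 * bessPhi 1 (B / 4)))) using 1
  simp [surfRatio]
  field_simp
  ring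

lemma hStar_one (B V : ℝ) : hStar B V 1 = 0 := by simp [hStar]

lemma continuous_hStar {B : ℝ} (hB : 0 < B) (V : ℝ) : Continuous (hStar B V) :=
  continuous_iff_continuousAt.2 fun x => (hasDerivAt_hStar hB V x).continuousAt

lemma contDiff_hStar {B : ℝ} (hB : 0 < B) (V : ℝ) : ContDiff ℝ 1 (hStar B V) := by
  refine contDiff_one_iff_deriv.2 ⟨fun x => (hasDerivAt_hStar hB V x).differentiableAt, ?_⟩
  rw [show deriv (hStar B V) = _ from funext fun x => (hasDerivAt_hStar hB V x).deriv]
  have := continuous_surfRatio B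
  fun_prop

lemma hStar_nonneg {B V r : ℝ} (hB : 0 < B) (hV : 0 < V) (hr : r ∈ Icc (0 : ℝ) 1) :
    0 ≤ hStar B V r := by
  have h : AntitoneOn (hStar B V) (Icc 0 1) := by
    refine antitoneOn_of_deriv_nonpos (convex_Icc 0 1) (continuous_hStar hB V).continuousOn
      (fun x _ => (hasDerivAt_hStar hB V x).differentiableAt.differentiableWithinAt) fun x hx => ?_
    rw [interior_Icc] at hx
    rw [(hasDerivAt_hStar hB V x).deriv, neg_nonpos]
    exact mul_nonneg (lamStar_pos hB hV).le
      (mul_nonneg hx.1.le (surfRatio_nonneg hB (Ioo_subset_Icc_self hx)))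
  have := h hr (right_mem_Icc.2 zero_le_one) hr.2
  rwa [hStar_one] at this

lemma hasDerivAt_surf_moment {B : ℝ} (hB : 0 < B) (r : ℝ) :
    HasDerivAt (fun r => r ^ 4 / 4 - r ^ 4 * bessPhi 2 (B / 4 * r ^ 2) / (2 * bessPhi 1 (B / 4)))
      (r * surfRatio B r * r * r) r := by
  have hD := (bessPhi_pos 1 (x := B / 4) (by positivity)).ne'
  convert! ((hasDerivAt_pow 4 r).div_const 4).sub
    (((hasDerivAt_pow 4 r).mul (hasDerivAt_bessPhi_sq 2 B r)).div_const (2 * bessPhi 1 (B / 4)))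
    using 1
  have := bessPhi_rec 1 (B / 4 * r ^ 2)
  norm_num at this
  rw [surfRatio, this]
  simp
  field_simp
  ring

/-- The coupling of the optimal surface with the potential `ψ = r`. -/
lemma integral_surf_moment {B : ℝ} (hB : 0 < B) :
    ∫ r in (0 : ℝ)..1, r * surfRatio B r * r * r = bracket B / 4 := by
  have hD := (bessPhi_pos 1 (x := B / 4) (by positivity)).ne'
  have hc := continuous_surfRatio B
  rw [intervalIntegral.integral_eq_sub_of_hasDerivAt (fun r _ => hasDerivAt_surf_moment hB r)
    (Continuous.intervalIntegrable (by fun_prop) _ _), bracket_eq hB]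
  norm_num
  field_simp
  ring

lemma integral_hStar {B : ℝ} (hB : 0 < B) (V : ℝ) :
    ∫ r in (0 : ℝ)..1, hStar B V r * r = V / (2 * Real.pi) := by
  have hb := (bracket_pos hB).ne'
  have hc := continuous_surfRatio B
  have hh := continuous_hStar hB V
  -- integration by parts against `r² / 2`, the boundary terms vanish
  have h0 : ∫ r in (0 : ℝ)..1,
      (hStar B V r * r + -(lamStar B V / 2) * (r * surfRatio B r * r * r)) = 0 := by
    rw [intervalIntegral.integral_eq_sub_of_hasDerivAt (f := fun r => hStar B V r * (r ^ 2 / 2))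
      (fun r _ => ?_) (Continuous.intervalIntegrable (by fun_prop) _ _)]
    · simp [hStar_one]
    · convert! (hasDerivAt_hStar hB V r).mul ((hasDerivAt_pow 2 r).div_const 2) using 1
      simp
      ring
  rw [intervalIntegral.integral_add (Continuous.intervalIntegrable (by fun_prop) _ _)
    (Continuous.intervalIntegrable (by fun_prop) _ _), intervalIntegral.integral_const_mul,
    integral_surf_moment hB] at h0
  rw [lamStar] at h0
  have : 4 * V / Real.pi * (bracket B)⁻¹ / 2 * (bracket B / 4) = V / (2 * Real.pi) := by
    field_simp
  linarith

lemma hStar_mem_shapeClass {B V : ℝ} (hB : 0 < B) (hV : 0 < V) : hStar B V ∈ shapeClass V :=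
  ⟨⟨(continuous_hStar hB V).continuousOn, 1, fun i => i, by simp, by simp, fun i _ =>
    ⟨by simp, (contDiff_hStar hB V).contDiffOn⟩⟩, fun _ hr => hStar_nonneg hB hV hr,
    integral_hStar hB V⟩

/-- The slope of the bottom `-h*` is positive inside and vanishes at the wall. -/
lemma not_convexOn_neg_hStar {B V : ℝ} (hB : 0 < B) (hV : 0 < V) :
    ¬ ConvexOn ℝ (Icc (0 : ℝ) 1) (fun r => -hStar B V r) := by
  intro h
  have hd (x : ℝ) := (hasDerivAt_hStar hB V x).fun_neg
  have h1 := h.deriv_le_slope (x := 1 / 2) (y := 1) (by norm_num) (by norm_num) (by norm_num)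
    (hd _).differentiableAt
  have h2 := h.slope_le_deriv (x := 1 / 2) (y := 1) (by norm_num) (by norm_num) (by norm_num)
    (hd _).differentiableAt
  rw [(hd _).deriv] at h1 h2
  rw [surfRatio_one hB] at h2
  have := surfRatio_pos hB (r := 1 / 2) (by norm_num)
  have := lamStar_pos hB hV
  have : 0 < - -(lamStar B V * (1 / 2 * surfRatio B (1 / 2))) := by rw [neg_neg]; positivity
  linarith

/-! ### The trial pair and the upper bound -/

lemma hasWeakDeriv_of_hasDerivAt {f g : ℝ → ℝ} (hd : ∀ x, HasDerivAt f (g x) x)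
    (hg : Continuous g) : HasWeakDeriv f g := by
  have hf : Continuous f := continuous_iff_continuousAt.2 fun x => (hd x).continuousAt
  refine ⟨hf.continuousOn.locallyIntegrableOn measurableSet_Ioo,
    hg.continuousOn.locallyIntegrableOn measurableSet_Ioo, fun η hη _ ht => ?_⟩
  have h0 : η 0 = 0 := image_eq_zero_of_notMem_tsupport fun h => (ht h).1.false
  have h1 : η 1 = 0 := image_eq_zero_of_notMem_tsupport fun h => (ht h).2.false
  rw [intervalIntegral.integral_mul_deriv_eq_deriv_mul (fun x _ => hd x)
    (fun x _ => (hη.differentiable (by simp) x).hasDerivAt) (hg.intervalIntegrable _ _)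
    ((hη.continuous_deriv (by simp)).intervalIntegrable _ _), h0, h1]
  ring

lemma memL2_one_of_continuous {f : ℝ → ℝ} (hf : Continuous f) : MemL2 1 f := by
  refine ⟨hf.aestronglyMeasurable, ?_⟩
  have : Continuous fun r => f r ^ 2 * r ^ (1 : ℤ) := by simp only [zpow_one]; fun_prop
  exact (this.integrableOn_Icc (a := 0) (b := 1)).mono_set Ioo_subset_Icc_self

/-- `C¹` functions vanishing at the axis belong to `V¹₁`. -/
lemma memV_of_hasDerivAt {w g : ℝ → ℝ} (hw : Continuous w)
    (hd : ∀ x, HasDerivAt (fun r => r * w r) (g x) x) (hg : Continuous g) :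
    MemV (fun r => r * w r) g := by
  have hf : Continuous fun r => r * w r := by fun_prop
  refine ⟨⟨memL2_one_of_continuous hf, hasWeakDeriv_of_hasDerivAt hd hg,
    memL2_one_of_continuous hg⟩, hf.aestronglyMeasurable, ?_⟩
  have : Continuous fun r => r * w r ^ 2 := by fun_prop
  refine ((this.integrableOn_Icc (a := 0) (b := 1)).mono_set Ioo_subset_Icc_self).congr_fun
    (fun r hr => ?_) measurableSet_Ioo
  have := hr.1.ne'
  simp only [zpow_neg_one]
  field_simp

lemma integral_congr_of_pos {F G : ℝ → ℝ} (h : ∀ r, 0 < r → F r = G r) :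
    ∫ r in (0 : ℝ)..1, F r = ∫ r in (0 : ℝ)..1, G r := by
  refine intervalIntegral.integral_congr_ae (Filter.Eventually.of_forall fun r hr => h r ?_)
  rw [uIoc_of_le zero_le_one] at hr
  exact hr.1

/-- The surface energy of `ζ₀` equals its coupling with `ψ = r`, by the equation
`(r ζ₀')' = ζ₀ / r + B r ζ₀ - B r²`. -/
lemma integral_surf_energy {B : ℝ} (hB : 0 < B) :
    ∫ r in (0 : ℝ)..1, ((r * surfRatio B r) ^ 2 +
      1 / B * (surfDeriv B r ^ 2 + surfRatio B r ^ 2)) * r = bracket B / 4 := by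
  have hD := (bessPhi_pos 1 (x := B / 4) (by positivity)).ne'
  have hc := continuous_surfRatio B
  have hn := continuous_surfDeriv B
  have key : ∫ r in (0 : ℝ)..1, (((r * surfRatio B r) ^ 2 +
      1 / B * (surfDeriv B r ^ 2 + surfRatio B r ^ 2)) * r - r * surfRatio B r * r * r) = 0 := by
    rw [intervalIntegral.integral_eq_sub_of_hasDerivAt
      (f := fun r => r * (r * surfRatio B r) * surfDeriv B r / B)
      (fun r _ => ?_) (Continuous.intervalIntegrable (by fun_prop) _ _)]
    · simp [surfRatio_one hB]
    · convert! ((((hasDerivAt_id r).mul (hasDerivAt_surf B r)).mul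
        (hasDerivAt_surfDeriv B r)).div_const B) using 1
      have h1 : bessPhi 1 (B / 4 * r ^ 2) = bessPhi 1 (B / 4) * (1 - surfRatio B r) := by
        rw [surfRatio]; field_simp; ring
      rw [surfDeriv, h1]
      simp
      field_simp
      ring
  rw [intervalIntegral.integral_sub (Continuous.intervalIntegrable (by fun_prop) _ _)
    (Continuous.intervalIntegrable (by fun_prop) _ _), integral_surf_moment hB] at key
  linarith

/-- The energy of the trial pair `(c r, s ζ₀)` depends on `h` only through its volume. -/
lemma energy_trial {B : ℝ} (hB : 0 < B) (h : ℝ → ℝ) (c s : ℝ) :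
    energy B 1 h (fun r => r * c) (fun _ => c) (fun r => r * (s * surfRatio B r))
      (fun r => s * surfDeriv B r) =
      c ^ 2 * (∫ r in (0 : ℝ)..1, h r * r) + s ^ 2 * bracket B / 8 := by
  have e1 : ∫ r in (0 : ℝ)..1, h r * (c ^ 2 + ((1 : ℕ) : ℝ) ^ 2 / r ^ 2 * (r * c) ^ 2) * r =
      (2 * c ^ 2) * ∫ r in (0 : ℝ)..1, h r * r := by
    rw [← intervalIntegral.integral_const_mul]
    refine integral_congr_of_pos fun r hr => ?_
    have := hr.ne'
    push_cast
    field_simp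
    ring
  have e2 : ∫ r in (0 : ℝ)..1, ((r * (s * surfRatio B r)) ^ 2 + 1 / B * ((s * surfDeriv B r) ^ 2 +
      ((1 : ℕ) : ℝ) ^ 2 / r ^ 2 * (r * (s * surfRatio B r)) ^ 2)) * r = s ^ 2 * (bracket B / 4) := by
    rw [← integral_surf_energy hB, ← intervalIntegral.integral_const_mul]
    refine integral_congr_of_pos fun r hr => ?_
    have := hr.ne'
    push_cast
    field_simp
  rw [energy, e1, e2]
  ring

/-- The trial pair `(c r, s ζ₀)`, balanced so that both energies equal `√λ* / 2`. -/
lemma sqrt_lamStar_mem_admissibleEnergies {B V : ℝ} (hB : 0 < B) (hV : 0 < V) {h : ℝ → ℝ}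
    (hh : h ∈ shapeClass V) : √(lamStar B V) ∈ admissibleEnergies B h := by
  have hb := bracket_pos hB
  have hl := lamStar_pos hB hV
  have hpi := Real.pi_pos
  have hL : 0 < √(lamStar B V) := Real.sqrt_pos.2 hl
  set L := √(lamStar B V) with hLdef
  have hL2 : L ^ 2 = 4 * V / (Real.pi * bracket B) := by
    rw [hLdef, Real.sq_sqrt hl.le, lamStar]; field_simp
  -- `c` makes the fluid energy `c² V / (2π)` equal to `L / 2`; `s` is then fixed by the coupling
  set c := √(Real.pi * L / V)
  have hc0 : 0 < c := Real.sqrt_pos.2 (by positivity)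
  have hc2 : c ^ 2 = Real.pi * L / V := Real.sq_sqrt (by positivity)
  set s := 4 / (bracket B * c)
  have hq := continuous_surfRatio B
  refine ⟨fun r => r * c, fun _ => c, fun r => r * (s * surfRatio B r),
    fun r => s * surfDeriv B r, memV_of_hasDerivAt continuous_const (fun x => ?_) continuous_const,
    ⟨memV_of_hasDerivAt (by fun_prop) (fun x => ?_) (continuous_const.mul (continuous_surfDeriv B)),
      _, Continuous.continuousOn (by fun_prop), Filter.EventuallyEq.rfl, ?_⟩, ?_, ?_⟩
  · simpa using (hasDerivAt_id x).mul_const c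
  · convert! (hasDerivAt_surf B x).const_mul s using 1
    ext r
    ring
  · simp [surfRatio_one hB]
  · have : (fun r => r * c * (r * (s * surfRatio B r)) * r) =
        fun r => (c * s) * (r * surfRatio B r * r * r) := by ext r; ring
    rw [this, intervalIntegral.integral_const_mul, integral_surf_moment hB]
    simp only [s]
    field_simp
  · rw [energy_trial hB, hh.2.2, hc2]
    have hs2 : s ^ 2 = 16 / (bracket B ^ 2 * c ^ 2) := by simp only [s]; field_simp; norm_num
    rw [hs2, hc2]
    field_simp
    rw [hL2]
    field_simp
    ring

lemma energy_nonneg {B : ℝ} (hB : 0 < B) {h : ℝ → ℝ} (hh : ∀ r ∈ Icc (0 : ℝ) 1, 0 ≤ h r)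
    (ψ ψ' ζ ζ' : ℝ → ℝ) : 0 ≤ energy B 1 h ψ ψ' ζ ζ' := by
  have e1 : 0 ≤ ∫ r in (0 : ℝ)..1, h r * (ψ' r ^ 2 + ((1 : ℕ) : ℝ) ^ 2 / r ^ 2 * ψ r ^ 2) * r :=
    intervalIntegral.integral_nonneg zero_le_one fun r hr =>
      mul_nonneg (mul_nonneg (hh r hr) (by positivity)) hr.1
  have e2 : 0 ≤ ∫ r in (0 : ℝ)..1,
      (ζ r ^ 2 + 1 / B * (ζ' r ^ 2 + ((1 : ℕ) : ℝ) ^ 2 / r ^ 2 * ζ r ^ 2)) * r :=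
    intervalIntegral.integral_nonneg zero_le_one fun r hr => mul_nonneg (by positivity) hr.1
  rw [energy]
  linarith

lemma admissibleEnergies_nonneg {B V : ℝ} (hB : 0 < B) {h : ℝ → ℝ} (hh : h ∈ shapeClass V) :
    ∀ e ∈ admissibleEnergies B h, 0 ≤ e := by
  rintro e ⟨ψ, ψ', ζ, ζ', -, -, -, rfl⟩
  exact energy_nonneg hB hh.2.1 ψ ψ' ζ ζ'

lemma fundamentalFreq_le {B V : ℝ} (hB : 0 < B) (hV : 0 < V) {h : ℝ → ℝ}
    (hh : h ∈ shapeClass V) : fundamentalFreq B h ≤ √(lamStar B V) :=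
  csInf_le ⟨0, admissibleEnergies_nonneg hB hh⟩ (sqrt_lamStar_mem_admissibleEnergies hB hV hh)

lemma lam_le_lamStar {B V : ℝ} (hB : 0 < B) (hV : 0 < V) {h : ℝ → ℝ}
    (hh : h ∈ shapeClass V) : lam B h ≤ lamStar B V := by
  rw [lam, ← Real.sq_sqrt (lamStar_pos hB hV).le]
  exact pow_le_pow_left₀ (Real.sInf_nonneg (admissibleEnergies_nonneg hB hh))
    (fundamentalFreq_le hB hV hh) 2

/-! ### The lower bound for the optimal profile -/

lemma MemL2.intervalIntegrable {k : ℤ} {f : ℝ → ℝ} (hf : MemL2 k f) :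
    IntervalIntegrable (fun r => f r ^ 2 * r ^ k) volume 0 1 :=
  (intervalIntegrable_iff_integrableOn_Ioo_of_le zero_le_one).2 hf.2

lemma sq_intervalIntegral_le {f : ℝ → ℝ} {a b : ℝ} (hab : a ≤ b)
    (hf : IntervalIntegrable f volume a b) (hf2 : IntervalIntegrable (fun x => f x ^ 2) volume a b) :
    (∫ x in a..b, f x) ^ 2 ≤ (b - a) * ∫ x in a..b, f x ^ 2 := by
  rcases hab.eq_or_lt with rfl | hlt
  · simp
  have hba : 0 < b - a := sub_pos.2 hlt
  set I := ∫ x in a..b, f x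
  -- the variance about the mean `t` is nonnegative
  set t := I / (b - a)
  have h : 0 ≤ ∫ x in a..b, (f x - t) ^ 2 :=
    intervalIntegral.integral_nonneg hab fun x _ => sq_nonneg _
  have e : ∫ x in a..b, (f x - t) ^ 2 = (∫ x in a..b, f x ^ 2) - 2 * t * I + t ^ 2 * (b - a) := by
    have : (fun x => (f x - t) ^ 2) = fun x => f x ^ 2 - 2 * t * f x + t ^ 2 := by ext x; ring
    rw [this, intervalIntegral.integral_add (hf2.sub (hf.const_mul _)) intervalIntegrable_const,
      intervalIntegral.integral_sub hf2 (hf.const_mul _), intervalIntegral.integral_const_mul,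
      intervalIntegral.integral_const]
    simp [I]
    ring
  rw [e] at h
  have h' := mul_nonneg hba.le h
  have : (b - a) * ((∫ x in a..b, f x ^ 2) - 2 * t * I + t ^ 2 * (b - a)) =
      (b - a) * (∫ x in a..b, f x ^ 2) - I ^ 2 := by simp only [t]; field_simp; ring
  linarith

/-- Functions in `L²₋₁` cannot stay away from `0` at the axis, since `1 / r` is not integrable. -/
lemma exists_sq_add_sq_lt {ψ ζ u v : ℝ → ℝ} (hψ : MemL2 (-1) ψ) (hζ : MemL2 (-1) ζ)
    (hu : ∀ᵐ x, x ∈ Ioo (0 : ℝ) 1 → ψ x = u x) (hv : ∀ᵐ x, x ∈ Ioo (0 : ℝ) 1 → ζ x = v x)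
    {ε : ℝ} (hε : 0 < ε) (hε1 : ε < 1) : ∃ a, 0 < a ∧ a < ε ∧ u a ^ 2 + v a ^ 2 < ε := by
  by_contra! hcon
  have hi : IntervalIntegrable (fun r => ψ r ^ 2 * r ^ (-1 : ℤ) + ζ r ^ 2 * r ^ (-1 : ℤ)) volume 0 ε :=
    (hψ.intervalIntegrable.add hζ.intervalIntegrable).mono_set (by
      rw [uIcc_of_le hε.le, uIcc_of_le zero_le_one]; exact Icc_subset_Icc_right hε1.le)
  have hinv : IntervalIntegrable (fun r : ℝ => ε * r⁻¹) volume 0 ε := by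
    refine hi.mono_fun (by fun_prop) ?_
    rw [Filter.EventuallyLE, ae_restrict_iff' measurableSet_uIoc]
    have hne : ∀ᵐ x : ℝ, x ≠ ε := by simp [ae_iff, measure_singleton]
    filter_upwards [hu, hv, hne] with x hxu hxv hxne hx
    rw [uIoc_of_le hε.le] at hx
    have hxε : x < ε := lt_of_le_of_ne hx.2 hxne
    have hx0 := hx.1
    rw [hxu ⟨hx.1, hxε.trans hε1⟩, hxv ⟨hx.1, hxε.trans hε1⟩, zpow_neg_one, ← add_mul,
      Real.norm_of_nonneg (by positivity), Real.norm_of_nonneg (by positivity)]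
    exact mul_le_mul_of_nonneg_right (hcon x hx.1 hxε) (by positivity)
  have h2 : IntervalIntegrable (fun r : ℝ => r⁻¹) volume 0 ε := by
    have := hinv.const_mul ε⁻¹
    simpa [← mul_assoc, hε.ne'] using this
  rcases intervalIntegrable_inv_iff.1 h2 with h3 | h3
  · exact hε.ne h3
  · exact h3 left_mem_uIcc

/-- Functions in `V¹₁` with zero trace are `o((1 - r)^(1/2))` at the wall. -/
lemma sq_le_of_zeroTrace {ζ ζ' v : ℝ → ℝ} (hζ' : MemL2 1 ζ') (h0 : ZeroTraceAtOne ζ)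
    (hac : ∀ a b, 0 < a → a ≤ b → b < 1 → AbsolutelyContinuousOnInterval v a b)
    (hv : ∀ᵐ x, x ∈ Ioo (0 : ℝ) 1 → ζ x = v x)
    (hd : ∀ᵐ x, x ∈ Ioo (0 : ℝ) 1 → HasDerivAt v (ζ' x) x) {b : ℝ} (hb : b ∈ Ico (1 / 2 : ℝ) 1) :
    v b ^ 2 ≤ (1 - b) * (2 * ∫ r in b..1, ζ' r ^ 2 * r) := by
  have hi := hζ'.intervalIntegrable
  simp only [zpow_one] at hi
  obtain ⟨g, hg, hgζ, hg1⟩ := h0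
  have hvc : ContinuousOn v (Ioo 0 1) := by
    intro x hx
    have hc := (hac (x / 2) ((x + 1) / 2) (by linarith [hx.1]) (by linarith [hx.1])
      (by linarith [hx.2])).continuousOn
    rw [uIcc_of_le (by linarith [hx.1])] at hc
    exact (hc.continuousAt (Icc_mem_nhds (by linarith [hx.1]) (by linarith [hx.2]))).continuousWithinAt
  have hgv : EqOn g v (Ioo 0 1) := by
    refine Measure.eqOn_open_of_ae_eq (μ := volume) ?_ isOpen_Ioo (hg.mono Ioo_subset_Ioc_self) hvc
    refine hgζ.trans ?_
    rw [Filter.EventuallyEq, ae_restrict_iff' measurableSet_Ioo]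
    exact hv
  have hlim : Filter.Tendsto v (nhdsWithin 1 (Iio 1)) (nhds 0) := by
    have h1 : Filter.Tendsto g (nhdsWithin 1 (Iio 1)) (nhds 0) := by
      rw [← hg1, ← nhdsWithin_Ioo_eq_nhdsLT (zero_lt_one' ℝ)]
      exact (hg 1 ⟨zero_lt_one, le_rfl⟩).mono_left (nhdsWithin_mono _ Ioo_subset_Ioc_self)
    refine h1.congr' ?_
    filter_upwards [Ioo_mem_nhdsLT (zero_lt_one' ℝ)] with x hx using hgv hx
  have hb0 : 0 < b := by linarith [hb.1]
  have hlim2 : Filter.Tendsto (fun s => (v s - v b) ^ 2) (nhdsWithin 1 (Iio 1))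
      (nhds ((0 - v b) ^ 2)) := (hlim.sub_const _).pow 2
  rw [zero_sub, neg_sq] at hlim2
  refine le_of_tendsto hlim2 ?_
  filter_upwards [Ioo_mem_nhdsLT hb.2] with s hs
  have hbs := hs.1.le
  have hAC := hac b s hb0 hbs hs.2
  have hae : ∀ᵐ x, x ∈ uIoc b s → deriv v x = ζ' x := by
    filter_upwards [hd] with x hx hxI
    rw [uIoc_of_le hbs] at hxI
    exact (hx ⟨hb0.trans hxI.1, hxI.2.trans_lt hs.2⟩).deriv
  have hsub : uIcc b s ⊆ uIcc 0 1 := by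
    rw [uIcc_of_le hbs, uIcc_of_le zero_le_one]
    exact Icc_subset_Icc hb0.le hs.2.le
  have hi1 : IntervalIntegrable ζ' volume b s :=
    hAC.intervalIntegrable_deriv.congr_ae ((ae_restrict_iff' measurableSet_uIoc).2 hae)
  have hi2 : IntervalIntegrable (fun x => ζ' x ^ 2) volume b s := by
    have hc : ContinuousOn (fun x : ℝ => x⁻¹) (uIcc b s) := by
      refine continuousOn_inv₀.mono fun x hx => ?_
      rw [uIcc_of_le hbs] at hx
      exact (hb0.trans_le hx.1).ne'
    refine ((hi.mono_set hsub).mul_continuousOn hc).congr_uIoo fun x hx => ?_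
    rw [uIoo_of_le hbs] at hx
    have := (hb0.trans hx.1).ne'
    simp only
    field_simp
  rw [← hAC.integral_deriv_eq_sub, intervalIntegral.integral_congr_ae hae]
  refine (sq_intervalIntegral_le hbs hi1 hi2).trans ?_
  refine mul_le_mul (by linarith [hs.2]) ?_
    (intervalIntegral.integral_nonneg hbs fun x _ => sq_nonneg _) (by linarith [hb.2])
  rw [← intervalIntegral.integral_const_mul]
  calc ∫ x in b..s, ζ' x ^ 2 ≤ ∫ x in b..s, 2 * (ζ' x ^ 2 * x) := by
        refine intervalIntegral.integral_mono_on hbs hi2 ((hi.mono_set hsub).const_mul 2)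
          fun x hx => ?_
        nlinarith [sq_nonneg (ζ' x), hb.1, hx.1]
    _ ≤ ∫ x in b..1, 2 * (ζ' x ^ 2 * x) := by
        refine intervalIntegral.integral_mono_interval le_rfl hbs hs.2.le ?_
          ((hi.const_mul 2).mono_set ?_)
        · rw [Filter.EventuallyLE, ae_restrict_iff' measurableSet_Ioc]
          refine Filter.Eventually.of_forall fun x hx => ?_
          have := hb0.trans hx.1
          simp only [Pi.zero_apply]
          positivity
        · rw [uIcc_of_le hb.2.le, uIcc_of_le zero_le_one]
          exact Icc_subset_Icc_left hb0.le

/-- The density of the energy `E_1(h; ψ, ζ)`. -/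
noncomputable def energyDensity (B : ℝ) (h ψ ψ' ζ ζ' : ℝ → ℝ) (r : ℝ) : ℝ :=
  1 / 2 * (h r * (ψ' r ^ 2 + 1 / r ^ 2 * ψ r ^ 2) * r) +
    1 / 2 * ((ζ r ^ 2 + 1 / B * (ζ' r ^ 2 + 1 / r ^ 2 * ζ r ^ 2)) * r)

lemma energyDensity_nonneg {B r : ℝ} (hB : 0 < B) {h : ℝ → ℝ} (hh : 0 ≤ h r) (hr : 0 ≤ r)
    (ψ ψ' ζ ζ' : ℝ → ℝ) : 0 ≤ energyDensity B h ψ ψ' ζ ζ' r := by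
  rw [energyDensity]
  positivity

lemma energy_eq_integral {B : ℝ} {h ψ ψ' ζ ζ' : ℝ → ℝ} (hh : Continuous h)
    (hψ : MemV ψ ψ') (hζ : MemV ζ ζ') :
    IntervalIntegrable (energyDensity B h ψ ψ' ζ ζ') volume 0 1 ∧
      energy B 1 h ψ ψ' ζ ζ' = ∫ r in (0 : ℝ)..1, energyDensity B h ψ ψ' ζ ζ' r := by
  have i1 : IntervalIntegrable (fun r => h r * (ψ' r ^ 2 + 1 / r ^ 2 * ψ r ^ 2) * r) volume 0 1 := by
    have := (hψ.1.2.2.intervalIntegrable.add hψ.2.intervalIntegrable).continuousOn_mul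
      hh.continuousOn
    refine this.congr_uIoo fun r hr => ?_
    rw [uIoo_of_le zero_le_one] at hr
    have := hr.1.ne'
    simp only [zpow_one, zpow_neg_one]
    field_simp
  have i2 : IntervalIntegrable (fun r => (ζ r ^ 2 + 1 / B * (ζ' r ^ 2 + 1 / r ^ 2 * ζ r ^ 2)) * r)
      volume 0 1 := by
    have := hζ.1.1.intervalIntegrable.add
      ((hζ.1.2.2.intervalIntegrable.add hζ.2.intervalIntegrable).const_mul (1 / B))
    refine this.congr_uIoo fun r hr => ?_
    rw [uIoo_of_le zero_le_one] at hr
    have := hr.1.ne'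
    simp only [zpow_one, zpow_neg_one]
    field_simp
  refine ⟨(i1.const_mul (1 / 2)).add (i2.const_mul (1 / 2)), ?_⟩
  simp only [energyDensity]
  rw [intervalIntegral.integral_add (i1.const_mul (1 / 2)) (i2.const_mul (1 / 2)),
    intervalIntegral.integral_const_mul, intervalIntegral.integral_const_mul, energy]
  simp

/-- Completing squares: twice the difference of the two sides is
`H r (u' - u/r)² + (r/B) (v' - P v/r)² + (r/q) (q L u - v)²`. Besides the coupling `L u v r`, the
left-hand side is half the derivative of `H u² + P v² / B` when `H' = -L² r q` and `P` solves the
Riccati equation of the optimal surface. -/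
lemma picone_pointwise {B r q H P L : ℝ} (hB : 0 < B) (hr : 0 < r) (hq : 0 < q) (hH : 0 ≤ H)
    (u u' v v' : ℝ) :
    1 / 2 * (-(L ^ 2 * (r * q)) * u ^ 2 + H * (2 * u * u') +
      ((1 / r + B * r - B * r / q - P ^ 2 / r) * v ^ 2 + P * (2 * v * v')) / B) + L * (u * v * r) ≤
    1 / 2 * (H * (u' ^ 2 + 1 / r ^ 2 * u ^ 2) * r) +
      1 / 2 * ((v ^ 2 + 1 / B * (v' ^ 2 + 1 / r ^ 2 * v ^ 2)) * r) := by
  have h : 0 ≤ 1 / 2 * (H * r * (u' - u / r) ^ 2 + r / B * (v' - P * v / r) ^ 2 +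
      r / q * (q * L * u - v) ^ 2) := by positivity
  rw [← sub_nonneg]
  convert! h using 1
  field_simp
  ring

lemma contDiff_surfRatio (B : ℝ) : ContDiff ℝ 1 (surfRatio B) := by
  refine contDiff_one_iff_deriv.2 ⟨fun x => (hasDerivAt_surfRatio B x).differentiableAt, ?_⟩
  rw [show deriv (surfRatio B) = _ from funext fun x => (hasDerivAt_surfRatio B x).deriv]
  have := continuous_bessPhi_sq 2 B
  fun_prop

lemma contDiff_surfDeriv (B : ℝ) : ContDiff ℝ 1 (surfDeriv B) := by
  refine contDiff_one_iff_deriv.2 ⟨fun x => (hasDerivAt_surfDeriv B x).differentiableAt, ?_⟩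
  rw [show deriv (surfDeriv B) = _ from funext fun x => (hasDerivAt_surfDeriv B x).deriv]
  have h1 := continuous_bessPhi_sq 1 B
  have h2 := continuous_bessPhi_sq 2 B
  fun_prop

/-- The pointwise estimate integrated over an interval that avoids the axis and the wall. -/
lemma flux_add_coupling_le_energy {B V : ℝ} (hB : 0 < B) (hV : 0 < V) {ψ ψ' ζ ζ' u v : ℝ → ℝ}
    (hψ : MemV ψ ψ') (hζ : MemV ζ ζ')
    (huac : ∀ a b, 0 < a → a ≤ b → b < 1 → AbsolutelyContinuousOnInterval u a b)
    (hu : ∀ᵐ x, x ∈ Ioo (0 : ℝ) 1 → ψ x = u x)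
    (hud : ∀ᵐ x, x ∈ Ioo (0 : ℝ) 1 → HasDerivAt u (ψ' x) x)
    (hvac : ∀ a b, 0 < a → a ≤ b → b < 1 → AbsolutelyContinuousOnInterval v a b)
    (hv : ∀ᵐ x, x ∈ Ioo (0 : ℝ) 1 → ζ x = v x)
    (hvd : ∀ᵐ x, x ∈ Ioo (0 : ℝ) 1 → HasDerivAt v (ζ' x) x)
    (hint : IntervalIntegrable (fun r => ψ r * ζ r * r) volume 0 1)
    {a b : ℝ} (ha : 0 < a) (hab : a ≤ b) (hb : b < 1) :
    1 / 2 * ((hStar B V b * u b ^ 2 + surfLogDeriv B b * v b ^ 2 / B) -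
      (hStar B V a * u a ^ 2 + surfLogDeriv B a * v a ^ 2 / B)) +
      √(lamStar B V) * (∫ r in a..b, ψ r * ζ r * r) ≤ energy B 1 (hStar B V) ψ ψ' ζ ζ' := by
  set L := √(lamStar B V)
  have hL : L ^ 2 = lamStar B V := Real.sq_sqrt (lamStar_pos hB hV).le
  obtain ⟨hGi, hGe⟩ := energy_eq_integral (B := B) (continuous_hStar hB V) hψ hζ
  let F : ℝ → ℝ := fun r => hStar B V r * (u r * u r) + 1 / B * (surfLogDeriv B r * (v r * v r))
  have hPac : AbsolutelyContinuousOnInterval (surfLogDeriv B) a b := by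
    refine ContDiffOn.absolutelyContinuousOnInterval ?_
    refine (contDiff_surfDeriv B).contDiffOn.div (contDiff_surfRatio B).contDiffOn fun x hx => ?_
    rw [uIcc_of_le hab] at hx
    exact (surfRatio_pos hB ⟨ha.le.trans hx.1, hx.2.trans_lt hb⟩).ne'
  have hhac : AbsolutelyContinuousOnInterval (hStar B V) a b :=
    (contDiff_hStar hB V).contDiffOn.absolutelyContinuousOnInterval
  have hUac := huac a b ha hab hb
  have hVac := hvac a b ha hab hb
  have hFac : AbsolutelyContinuousOnInterval F a b :=
    (hhac.fun_mul (hUac.fun_mul hUac)).fun_add ((hPac.fun_mul (hVac.fun_mul hVac)).const_mul (1 / B))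
  have hFTC := hFac.integral_deriv_eq_sub
  have hsub : uIcc a b ⊆ uIcc 0 1 := by
    rw [uIcc_of_le hab, uIcc_of_le zero_le_one]
    exact Icc_subset_Icc ha.le hb.le
  have hFi := hFac.intervalIntegrable_deriv.const_mul (1 / 2)
  have hCi := (hint.mono_set hsub).const_mul L
  have hpt : ∀ᵐ r, r ∈ Icc a b →
      1 / 2 * deriv F r + L * (ψ r * ζ r * r) ≤ energyDensity B (hStar B V) ψ ψ' ζ ζ' r := by
    filter_upwards [hu, hud, hv, hvd] with r h1 h2 h3 h4 hr
    have hI : r ∈ Ioo (0 : ℝ) 1 := ⟨ha.trans_le hr.1, hr.2.trans_lt hb⟩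
    have dF := ((hasDerivAt_hStar hB V r).mul ((h2 hI).mul (h2 hI))).add
      (((hasDerivAt_surfLogDeriv hB hI).mul ((h4 hI).mul (h4 hI))).const_mul (1 / B))
    have dF' : deriv F r = _ := dF.deriv
    rw [dF', energyDensity, h1 hI, h3 hI]
    refine le_of_eq_of_le ?_ (picone_pointwise (L := L) (P := surfLogDeriv B r) hB hI.1
      (surfRatio_pos hB ⟨hI.1.le, hI.2⟩)
      (hStar_nonneg hB hV (Ioo_subset_Icc_self hI)) (u r) (ψ' r) (v r) (ζ' r))
    rw [hL]
    simp only [Pi.mul_apply]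
    ring
  calc _ = ∫ r in a..b, (1 / 2 * deriv F r + L * (ψ r * ζ r * r)) := by
        rw [intervalIntegral.integral_add hFi hCi, intervalIntegral.integral_const_mul,
          intervalIntegral.integral_const_mul, hFTC]
        simp only [F]
        ring
    _ ≤ ∫ r in a..b, energyDensity B (hStar B V) ψ ψ' ζ ζ' r := by
        refine intervalIntegral.integral_mono_ae_restrict hab (hFi.add hCi) (hGi.mono_set hsub) ?_
        rw [Filter.EventuallyLE, ae_restrict_iff' measurableSet_Icc]
        exact hpt
    _ ≤ ∫ r in (0 : ℝ)..1, energyDensity B (hStar B V) ψ ψ' ζ ζ' r := by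
        refine intervalIntegral.integral_mono_interval ha.le hab hb.le ?_ hGi
        rw [Filter.EventuallyLE, ae_restrict_iff' measurableSet_Ioc]
        exact Filter.Eventually.of_forall fun r hr =>
          energyDensity_nonneg hB (hStar_nonneg hB hV (Ioc_subset_Icc_self hr)) hr.1.le _ _ _ _
    _ = _ := hGe.symm

/-- Near the axis the boundary flux is controlled by `u² + v²`. -/
lemma exists_flux_le {B V : ℝ} (hB : 0 < B) : ∃ C, ∀ a ∈ Icc (0 : ℝ) (1 / 2), ∀ x y : ℝ,
    hStar B V a * x ^ 2 + surfLogDeriv B a * y ^ 2 / B ≤ C * (x ^ 2 + y ^ 2) := by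
  have hc : ContinuousOn (fun a => max (hStar B V a) (surfLogDeriv B a / B)) (Icc 0 (1 / 2)) := by
    refine (continuous_hStar hB V).continuousOn.sup (ContinuousOn.div_const ?_ _)
    refine (continuous_surfDeriv B).continuousOn.div (continuous_surfRatio B).continuousOn
      fun x hx => (surfRatio_pos hB ⟨hx.1, by linarith [hx.2]⟩).ne'
  obtain ⟨C, hC⟩ := (isCompact_Icc.image_of_continuousOn hc).bddAbove
  refine ⟨C, fun a ha x y => ?_⟩
  have h := hC (mem_image_of_mem _ ha)
  have h1 := mul_le_mul_of_nonneg_right ((le_max_left _ _).trans h) (sq_nonneg x)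
  have h2 := mul_le_mul_of_nonneg_right ((le_max_right _ _).trans h) (sq_nonneg y)
  rw [div_mul_eq_mul_div] at h2
  linarith

/-- The logarithmic derivative of the optimal surface blows up at most like `1 / (1 - r)`. -/
lemma exists_le_surfLogDeriv {B : ℝ} (hB : 0 < B) : ∃ C, 0 ≤ C ∧ ∀ b ∈ Ico (0 : ℝ) 1,
    -(C / (1 - b)) ≤ surfLogDeriv B b := by
  obtain ⟨M, hM⟩ := (isCompact_Icc (a := (0 : ℝ)) (b := 1)).exists_bound_of_continuousOn
    (continuous_surfDeriv B).continuousOn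
  have hD := bessPhi_pos 1 (x := B / 4) (by positivity)
  have h2 := bessPhi_pos 2 (x := 0) le_rfl
  have hM0 : 0 ≤ M := (norm_nonneg _).trans (hM 0 (by simp))
  set c := bessPhi 2 0 * (B / 4) / bessPhi 1 (B / 4)
  have hc : 0 < c := by positivity
  refine ⟨M / c, by positivity, fun b hb => ?_⟩
  have h1 : 0 < 1 - b := by linarith [hb.2]
  have hq := surfRatio_ge hB (Ico_subset_Icc_self hb)
  have hqp := surfRatio_pos hB hb
  have hN := neg_le_of_abs_le (hM b (Ico_subset_Icc_self hb))
  rw [surfLogDeriv, div_div, neg_le]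
  calc -(surfDeriv B b / surfRatio B b) = -surfDeriv B b / surfRatio B b := by ring
    _ ≤ M / surfRatio B b := by gcongr; linarith
    _ ≤ M / (c * (1 - b)) := by gcongr

/-- The optimality of `h*`: every admissible pair has energy at least `√λ*`. -/
lemma sqrt_lamStar_le_energy {B V : ℝ} (hB : 0 < B) (hV : 0 < V) {ψ ψ' ζ ζ' : ℝ → ℝ}
    (hψ : MemV ψ ψ') (hζ : MemVZero ζ ζ') (h1 : ∫ r in (0 : ℝ)..1, ψ r * ζ r * r = 1) :
    √(lamStar B V) ≤ energy B 1 (hStar B V) ψ ψ' ζ ζ' := by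
  obtain ⟨u, huac, hu, hud⟩ := hψ.1.2.1.exists_absolutelyContinuous
  obtain ⟨v, hvac, hv, hvd⟩ := hζ.1.1.2.1.exists_absolutelyContinuous
  -- a non-integrable coupling would have the default integral `0`
  have hint : IntervalIntegrable (fun r => ψ r * ζ r * r) volume 0 1 :=
    intervalIntegral.intervalIntegrable_of_integral_ne_zero (by rw [h1]; exact one_ne_zero)
  have hζi := hζ.1.1.2.2.intervalIntegrable
  simp only [zpow_one] at hζi
  obtain ⟨C, hC⟩ := exists_flux_le (V := V) hB
  obtain ⟨D, hD0, hD⟩ := exists_le_surfLogDeriv hB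
  set L := √(lamStar B V)
  let ε : ℕ → ℝ := fun n => 1 / ((n : ℝ) + 3)
  have hε0 (n : ℕ) : 0 < ε n := by positivity
  have hε3 (n : ℕ) : ε n ≤ 1 / 3 := by simp only [ε]; gcongr; simp
  have hεlim : Filter.Tendsto ε Filter.atTop (nhds 0) :=
    (tendsto_const_nhds.div_atTop
      (Filter.tendsto_atTop_add_const_right _ 3 tendsto_natCast_atTop_atTop))
  -- only a sequence of radii is available at the axis, so both endpoints move along sequences
  choose a ha0 haε hauv using fun n =>
    exists_sq_add_sq_lt hψ.2 hζ.1.2 hu hv (hε0 n) (by linarith [hε3 n])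
  let b : ℕ → ℝ := fun n => 1 - ε n
  have hbI (n : ℕ) : b n ∈ Ico (1 / 2 : ℝ) 1 := ⟨by linarith [hε3 n, show b n = 1 - ε n from rfl],
    by linarith [hε0 n, show b n = 1 - ε n from rfl]⟩
  have halim : Filter.Tendsto a Filter.atTop (nhds 0) :=
    tendsto_of_tendsto_of_tendsto_of_le_of_le tendsto_const_nhds hεlim (fun n => (ha0 n).le)
      (fun n => (haε n).le)
  have hblim : Filter.Tendsto b Filter.atTop (nhds 1) := by
    simpa using hεlim.const_sub (1 : ℝ)
  have hprim (f : ℝ → ℝ) (hf : IntervalIntegrable f volume 0 1) (s : ℕ → ℝ) (x : ℝ)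
      (hs : ∀ n, s n ∈ Icc (0 : ℝ) 1) (hx : x ∈ Icc (0 : ℝ) 1)
      (hsx : Filter.Tendsto s Filter.atTop (nhds x)) :
      Filter.Tendsto (fun n => ∫ r in (0 : ℝ)..s n, f r) Filter.atTop
        (nhds (∫ r in (0 : ℝ)..x, f r)) := by
    have hc := intervalIntegral.continuousOn_primitive_interval' hf left_mem_uIcc
    rw [uIcc_of_le zero_le_one] at hc
    exact (hc x hx).tendsto.comp
      (tendsto_nhdsWithin_iff.2 ⟨hsx, Filter.Eventually.of_forall hs⟩)
  have haI (n : ℕ) : a n ∈ Icc (0 : ℝ) 1 := ⟨(ha0 n).le, by linarith [haε n, hε3 n]⟩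
  have hbI' (n : ℕ) : b n ∈ Icc (0 : ℝ) 1 := ⟨by linarith [(hbI n).1], (hbI n).2.le⟩
  have hmono (f : ℝ → ℝ) (hf : IntervalIntegrable f volume 0 1) {x y : ℝ} (hx : x ∈ Icc (0 : ℝ) 1)
      (hy : y ∈ Icc (0 : ℝ) 1) : IntervalIntegrable f volume x y :=
    hf.mono_set (by rw [uIcc_of_le zero_le_one]; exact (convex_Icc 0 1).ordConnected.uIcc_subset hx hy)
  have hz : (0 : ℝ) ∈ Icc (0 : ℝ) 1 := by simp
  have ho : (1 : ℝ) ∈ Icc (0 : ℝ) 1 := by simp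
  have hJ : Filter.Tendsto (fun n => ∫ r in a n..b n, ψ r * ζ r * r) Filter.atTop (nhds 1) := by
    have := (hprim _ hint b 1 hbI' ho hblim).sub (hprim _ hint a 0 haI hz halim)
    rw [h1, intervalIntegral.integral_same, sub_zero] at this
    refine this.congr fun n => ?_
    rw [intervalIntegral.integral_interval_sub_left (hmono _ hint hz (hbI' n))
      (hmono _ hint hz (haI n))]
  have hT : Filter.Tendsto (fun n => ∫ r in b n..1, ζ' r ^ 2 * r) Filter.atTop (nhds 0) := by
    have := (hprim _ hζi b 1 hbI' ho hblim).const_sub (∫ r in (0 : ℝ)..1, ζ' r ^ 2 * r)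
    rw [sub_self] at this
    refine this.congr fun n => ?_
    rw [intervalIntegral.integral_interval_sub_left hζi (hmono _ hζi hz (hbI' n))]
  have hW : Filter.Tendsto (fun n => u (a n) ^ 2 + v (a n) ^ 2) Filter.atTop (nhds 0) :=
    tendsto_of_tendsto_of_tendsto_of_le_of_le tendsto_const_nhds hεlim (fun n => by positivity)
      (fun n => (hauv n).le)
  have hlim : Filter.Tendsto (fun n => 1 / 2 * (-(2 * D / B * ∫ r in b n..1, ζ' r ^ 2 * r) -
      C * (u (a n) ^ 2 + v (a n) ^ 2)) + L * ∫ r in a n..b n, ψ r * ζ r * r) Filter.atTop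
      (nhds (1 / 2 * (-(2 * D / B * 0) - C * 0) + L * 1)) :=
    ((((hT.const_mul _).neg).sub (hW.const_mul C)).const_mul (1 / 2)).add (hJ.const_mul L)
  rw [show 1 / 2 * (-(2 * D / B * 0) - C * 0) + L * 1 = L by ring] at hlim
  refine le_of_tendsto hlim (Filter.Eventually.of_forall fun n => ?_)
  have hmain := flux_add_coupling_le_energy hB hV hψ hζ.1 huac hu hud hvac hv hvd hint (ha0 n)
    (by linarith [haε n, hε3 n, (hbI n).1]) (hbI n).2
  have hA := hC (a n) ⟨(ha0 n).le, by linarith [haε n, hε3 n]⟩ (u (a n)) (v (a n))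
  have hv2 := sq_le_of_zeroTrace hζ.1.1.2.2 hζ.2 hvac hv hvd (hbI n)
  have hb1 : 0 < 1 - b n := by linarith [(hbI n).2]
  have hP := mul_le_mul_of_nonneg_right (hD (b n) ⟨(hbI' n).1, (hbI n).2⟩) (sq_nonneg (v (b n)))
  have hP2 : -(2 * D * ∫ r in b n..1, ζ' r ^ 2 * r) ≤ surfLogDeriv B (b n) * v (b n) ^ 2 := by
    refine le_trans ?_ hP
    rw [neg_mul, neg_le_neg_iff]
    calc D / (1 - b n) * v (b n) ^ 2
        ≤ D / (1 - b n) * ((1 - b n) * (2 * ∫ r in b n..1, ζ' r ^ 2 * r)) := by gcongr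
      _ = 2 * D * ∫ r in b n..1, ζ' r ^ 2 * r := by field_simp
  have hP3 : -(2 * D / B * ∫ r in b n..1, ζ' r ^ 2 * r) ≤ surfLogDeriv B (b n) * v (b n) ^ 2 / B := by
    rw [le_div_iff₀ hB]
    refine le_of_eq_of_le ?_ hP2
    field_simp
  have hh := mul_nonneg (hStar_nonneg hB hV (hbI' n)) (sq_nonneg (u (b n)))
  linarith

lemma lam_hStar {B V : ℝ} (hB : 0 < B) (hV : 0 < V) : lam B (hStar B V) = lamStar B V := by
  have hmem := hStar_mem_shapeClass hB hV
  have h : fundamentalFreq B (hStar B V) = √(lamStar B V) := by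
    refine le_antisymm (fundamentalFreq_le hB hV hmem)
      (le_csInf ⟨_, sqrt_lamStar_mem_admissibleEnergies hB hV hmem⟩ ?_)
    rintro e ⟨ψ, ψ', ζ, ζ', hψ, hζ, h1, rfl⟩
    exact sqrt_lamStar_le_energy hB hV hψ hζ h1
  rw [lam, h, Real.sq_sqrt (lamStar_pos hB hV).le]

end Sloshing

theorem theorem1p4 (B V : ℝ) (hB : 0 < B) (hV : 0 < V) :
    0 < Sloshing.bracket B ∧
    (∀ h ∈ Sloshing.shapeClass V, Sloshing.lam B h ≤ Sloshing.lamStar B V) ∧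
    Sloshing.hStar B V ∈ Sloshing.shapeClass V ∧
    Sloshing.lam B (Sloshing.hStar B V) = Sloshing.lamStar B V ∧
    ¬ ConvexOn ℝ (Set.Icc (0 : ℝ) 1) (fun r => -Sloshing.hStar B V r) := by
  exact ⟨Sloshing.bracket_pos hB, fun h hh => Sloshing.lam_le_lamStar hB hV hh,
    Sloshing.hStar_mem_shapeClass hB hV, Sloshing.lam_hStar hB hV,
    Sloshing.not_convexOn_neg_hStar hB hV⟩
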